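/- Consider formulas of the intuitionistic predicate language: countably many individual variables, countably many predicate letters of every arity, the constant $\bot$, the connectives $\wedge,\vee,\to$ and the quantifiers $\forall,\exists$ (no equality, constants or function symbols). An intuitionistic Kripke frame is a non-empty partially ordered set $\langle W,R\rangle$; it is linear if $R$ is a linear order. An augmented frame over it assigns to every world $w$ a non-empty domain $D_w$ such that $wRw'$ implies $D_w\subseteq D_{w'}$. Models on augmented frames (with hereditary interpretations of the predicate letters) and truth at worlds are those of the usual Kripke semantics for intuitionistic predicate logic, and a formula is valid on an augmented frame if, in every model on it, it is true at every world $w$ for all values of its free variables in $D_w$. Let $\mathbf{QLC}$ be the set of formulas valid on all augmented frames over linear Kripke frames, and let $\mathbf{QSIL}(\langle\mathbb N,\leqslant\rangle\odot\mathbb N)$ be the set of formulas valid on the augmented frame over $\langle\mathbb N,\leqslant\rangle$ in which the domain of every world is $\mathbb N$. Theorem. Let $L$ be a set of formulas (for instance, a superintuitionistic predicate logic) such that $$\mathbf{QLC}\subseteq L\subseteq \mathbf{QSIL}(\langle\mathbb N,\leqslant\rangle\odot\mathbb N).$$ Then $L$ is $\Sigma^0_1$-hard in the language with two individual variables, a single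 binary predicate letter and infinitely many unary predicate letters. That is, for every recursively enumerable set $A\subseteq\mathbb N$ there is a computable function assigning to each $n\in\mathbb N$ a formula $\varphi_n$ in which only two fixed individual variables $x,y$ (free or bound), one fixed binary predicate letter and unary predicate letters occur, such that for all $n$: $n\in A$ if and only if $\varphi_n\in L$. -/

import Mathlib

universe u

namespace SIL

/-- Formulas of the intuitionistic predicate language: individual variables are the natural
numbers, and for every arity `n` there are countably many `n`-ary predicate letters, the `k`-th of
which is applied to a tuple `xs` of variables in `atom n k xs`. There are no function symbols, no
individual constants and no equality. -/
inductive Formula : Type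
  | bot : Formula
  | atom (n k : ℕ) (xs : Fin n → ℕ) : Formula
  | and (φ ψ : Formula) : Formula
  | or (φ ψ : Formula) : Formula
  | imp (φ ψ : Formula) : Formula
  | all (x : ℕ) (φ : Formula) : Formula
  | ex (x : ℕ) (φ : Formula) : Formula

namespace Formula

/-- The free variables of a formula. -/
def freeVars : Formula → Set ℕ
  | bot => ∅
  | atom _ _ xs => Set.range xs
  | and φ ψ => φ.freeVars ∪ ψ.freeVars
  | or φ ψ => φ.freeVars ∪ ψ.freeVars
  | imp φ ψ => φ.freeVars ∪ ψ.freeVars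
  | all x φ => φ.freeVars \ {x}
  | ex x φ => φ.freeVars \ {x}

/-- The formulas in which only the two individual variables `0` and `1` occur (free or bound), and
in which every predicate letter is either one fixed binary letter or a unary letter. -/
def InTwoVarLanguage : Formula → Prop
  | bot => True
  | atom n k xs => ((n = 2 ∧ k = 0) ∨ n = 1) ∧ ∀ i, xs i = 0 ∨ xs i = 1
  | and φ ψ => φ.InTwoVarLanguage ∧ ψ.InTwoVarLanguage
  | or φ ψ => φ.InTwoVarLanguage ∧ ψ.InTwoVarLanguage
  | imp φ ψ => φ.InTwoVarLanguage ∧ ψ.InTwoVarLanguage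
  | all x φ => (x = 0 ∨ x = 1) ∧ φ.InTwoVarLanguage
  | ex x φ => (x = 0 ∨ x = 1) ∧ φ.InTwoVarLanguage

/-- The Gödel number of a formula. -/
def code : Formula → ℕ
  | bot => Nat.pair 0 0
  | atom n k xs => Nat.pair 1 (Nat.pair n (Nat.pair k (Encodable.encode (List.ofFn xs))))
  | and φ ψ => Nat.pair 2 (Nat.pair φ.code ψ.code)
  | or φ ψ => Nat.pair 3 (Nat.pair φ.code ψ.code)
  | imp φ ψ => Nat.pair 4 (Nat.pair φ.code ψ.code)
  | all x φ => Nat.pair 5 (Nat.pair x φ.code)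
  | ex x φ => Nat.pair 6 (Nat.pair x φ.code)

/-- Gödel numbers determine formulas. -/
theorem code_injective : Function.Injective code := by
  intro φ
  induction φ with
  | bot => intro ψ h; cases ψ <;> simp [code, Nat.pair_eq_pair] at h ⊢
  | atom n k xs =>
    intro ψ h
    cases ψ <;> simp only [code, Nat.pair_eq_pair] at h <;> try omega
    obtain ⟨-, rfl, rfl, h⟩ := h
    rw [List.ofFn_injective (Encodable.encode_injective h)]
  | and φ ψ ih₁ ih₂ | or φ ψ ih₁ ih₂ | imp φ ψ ih₁ ih₂ =>
    intro χ h
    cases χ <;> simp only [code, Nat.pair_eq_pair] at h <;> try omega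
    rw [ih₁ h.2.1, ih₂ h.2.2]
  | all x φ ih | ex x φ ih =>
    intro χ h
    cases χ <;> simp only [code, Nat.pair_eq_pair] at h <;> try omega
    rw [h.2.1, ih h.2.2]

end Formula

/-- Intuitionistic Kripke frames: non-empty partially ordered sets of worlds. -/
structure KripkeFrame : Type (u + 1) where
  World : Type u
  nonempty : Nonempty World
  R : World → World → Prop
  refl : ∀ w, R w w
  trans : ∀ u v w, R u v → R v w → R u w
  antisymm : ∀ u v, R u v → R v u → u = v

/-- A Kripke frame is linear if its accessibility relation is a linear order. -/
def KripkeFrame.IsLinear (F : KripkeFrame.{u}) : Prop :=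
  ∀ v w, F.R v w ∨ F.R w v

/-- Intuitionistic augmented frames: Kripke frames with non-empty expanding domains. -/
structure AugmentedFrame : Type (u + 1) extends KripkeFrame.{u} where
  /-- the individuals -/
  Ind : Type u
  /-- the domain of a world -/
  D : World → Set Ind
  dom_nonempty : ∀ w, (D w).Nonempty
  dom_expanding : ∀ v w, R v w → D v ⊆ D w

/-- The augmented frame over `F` in which the domain of every world is the whole of `Ind`. -/
def KripkeFrame.constDomain (F : KripkeFrame.{u}) (Ind : Type u) [Nonempty Ind] :
    AugmentedFrame.{u} where
  toKripkeFrame := F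
  Ind := Ind
  D := fun _ => Set.univ
  dom_nonempty := fun _ => Set.univ_nonempty
  dom_expanding := fun _ _ _ => subset_rfl

/-- Kripke models on an augmented frame: `I w n k` is the relation on the domain of `w` that
interprets the `k`-th `n`-ary predicate letter at `w`. -/
structure Model (𝔉 : AugmentedFrame.{u}) : Type u where
  I : 𝔉.World → (n k : ℕ) → Set (Fin n → 𝔉.Ind)
  mem_dom : ∀ w n k, ∀ a ∈ I w n k, ∀ i, a i ∈ 𝔉.D w
  heredity : ∀ v w, 𝔉.R v w → ∀ n k, I v n k ⊆ I w n k

/-- Truth of a formula at a world under an assignment. -/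
def Model.Forces {𝔉 : AugmentedFrame.{u}} (M : Model 𝔉) :
    𝔉.World → (ℕ → 𝔉.Ind) → Formula → Prop
  | _, _, .bot => False
  | w, g, .atom n k xs => (fun i => g (xs i)) ∈ M.I w n k
  | w, g, .and φ ψ => M.Forces w g φ ∧ M.Forces w g ψ
  | w, g, .or φ ψ => M.Forces w g φ ∨ M.Forces w g ψ
  | w, g, .imp φ ψ => ∀ v, 𝔉.R w v → M.Forces v g φ → M.Forces v g ψ
  | w, g, .all x φ => ∀ v, 𝔉.R w v → ∀ a ∈ 𝔉.D v, M.Forces v (Function.update g x a) φ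
  | w, g, .ex x φ => ∃ a ∈ 𝔉.D w, M.Forces w (Function.update g x a) φ

/-- A formula is valid on an augmented frame if, in every model on the frame, it is true at every
world `w` under every assignment that sends its free variables to individuals of `w`. -/
def AugmentedFrame.Validates (𝔉 : AugmentedFrame.{u}) (φ : Formula) : Prop :=
  ∀ (M : Model 𝔉) (w : 𝔉.World) (g : ℕ → 𝔉.Ind),
    (∀ x ∈ φ.freeVars, g x ∈ 𝔉.D w) → M.Forces w g φ

/-- The superintuitionistic predicate logic of a class of augmented frames. -/
def QSIL (C : Set AugmentedFrame.{u}) : Set Formula :=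
  {φ | ∀ 𝔉 ∈ C, 𝔉.Validates φ}

/-- `QLC`, the logic of the class of linear Kripke frames (with expanding domains). -/
def QLC : Set Formula :=
  QSIL {𝔉 : AugmentedFrame.{u} | 𝔉.toKripkeFrame.IsLinear}

/-- The Kripke frame `⟨ℕ, ≤⟩`. -/
def natFrame : KripkeFrame.{0} where
  World := ℕ
  nonempty := ⟨0⟩
  R := (· ≤ ·)
  refl := le_refl
  trans := fun _ _ _ => le_trans
  antisymm := fun _ _ => le_antisymm

/-- A set `L` of formulas is `Σ⁰₁`-hard in the language `Lang` (a set of formulas) if every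
recursively enumerable set of natural numbers is many-one reducible to the problem whether a given
formula of `Lang` belongs to `L`. -/
def SigmaZeroOneHardIn (Lang L : Set Formula) : Prop :=
  ∀ A : Set ℕ, REPred (fun n => n ∈ A) →
    ∃ f : ℕ → Formula, Computable (fun n => (f n).code) ∧
      ∀ n, f n ∈ Lang ∧ (n ∈ A ↔ f n ∈ L)

end SIL

/-!
Every recursively enumerable set reduces to the (un)satisfiability of classical two-variable
sentences whose atoms are equations `F s = G t` between unary functions applied to variables, and
these sentences are interpreted in intuitionistic logic of Kripke frames by monadic formulas with
the same two variables.

*Interpretation.* In a Kripke model, an individual `a` and a unary letter `P` determine the set of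
worlds where `P` holds of `a`, so a unary letter acts as a unary function from individuals to
up-sets. An equation `F s = G t` becomes the equivalence of the two atoms. An inequation becomes
`((p → q) → q) ∧ (q → B)`, or the same with `p` and `q` exchanged, where `B` is a fixed sentence
that is assumed to fail: if `p` and `q` held at the same later worlds, the first conjunct would
give `q` and the second `B`. Hence a world where `B` fails but the universal closure of the
translation of `ψ` holds carries a classical model of `ψ`
(`EqFormula.holds_of_forces`). Conversely, a model of `ψ` with domain `ℕ` and values in `ℕ` is
turned into a model on `⟨ℕ, ≤⟩ ⊙ ℕ` by letting `F` hold of `a` from the world `F a + 1` on, and `B`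
from the world `1` on; for distinct thresholds one of the two disjuncts of the inequation is true
because the worlds are linearly ordered (`EqFormula.forces_of_holds`).

*Undecidability.* Two variables suffice to axiomatize composition, pairing and primitive recursion
of unary functions on `ℕ`. Composition `c = a ∘ b`, for instance, reads
`∀ x ∃ y (y = b x ∧ a y = c x)`. In every model of the axioms the primitive recursive functions
take the intended values on the standard numbers (`IsArithModel.correctAt`). A recursively
enumerable set has the form `{n | ∃ m, (unpair m).1 = n ∧ f m = 0}` with `f` primitive recursive,
and the sentence that denies the existence of such an `m` has a model exactly when `n` is outside
the set: the standard model serves for one direction, the absoluteness of values on standard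
numbers for the other.
-/

namespace SIL

/-! ### Unary primitive recursive functions -/

/-- Names of unary primitive recursive functions. The name `lt` is redundant, but the comparison of
the two components of a number is what drives the recursive description of `Nat.unpair`. -/
inductive Fn : Type
  | id : Fn
  | zero : Fn
  | succ : Fn
  | left : Fn
  | right : Fn
  | lt : Fn
  | pair (a b : Fn) : Fn
  | comp (a b : Fn) : Fn
  | prec (a b : Fn) : Fn

namespace Fn

/-- The function with a given name. -/
def interp : Fn → ℕ → ℕ
  | id, m => m
  | zero, _ => 0
  | succ, m => m + 1
  | left, m => m.unpair.1
  | right, m => m.unpair.2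
  | lt, m => if m.unpair.1 < m.unpair.2 then 1 else 0
  | pair a b, m => Nat.pair (a.interp m) (b.interp m)
  | comp a b, m => a.interp (b.interp m)
  | prec a b, m => Nat.rec (a.interp m.unpair.1)
      (fun k v => b.interp (Nat.pair m.unpair.1 (Nat.pair k v))) m.unpair.2

theorem exists_interp_eq {f : ℕ → ℕ} (hf : Nat.Primrec f) : ∃ c : Fn, c.interp = f := by
  induction hf with
  | zero => exact ⟨zero, rfl⟩
  | succ => exact ⟨succ, rfl⟩
  | left => exact ⟨left, rfl⟩
  | right => exact ⟨right, rfl⟩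
  | pair _ _ iha ihb =>
    obtain ⟨a, rfl⟩ := iha
    obtain ⟨b, rfl⟩ := ihb
    exact ⟨pair a b, rfl⟩
  | comp _ _ iha ihb =>
    obtain ⟨a, rfl⟩ := iha
    obtain ⟨b, rfl⟩ := ihb
    exact ⟨comp a b, rfl⟩
  | prec _ _ iha ihb =>
    obtain ⟨a, rfl⟩ := iha
    obtain ⟨b, rfl⟩ := ihb
    exact ⟨prec a b, rfl⟩

/-- The number of the predicate letter that represents a function name; it is positive, so that the
letter `0` stays free for the refuted sentence. -/
def code : Fn → ℕ
  | id => Nat.pair 0 0 + 1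
  | zero => Nat.pair 1 0 + 1
  | succ => Nat.pair 2 0 + 1
  | left => Nat.pair 3 0 + 1
  | right => Nat.pair 4 0 + 1
  | lt => Nat.pair 5 0 + 1
  | pair a b => Nat.pair 6 (Nat.pair a.code b.code) + 1
  | comp a b => Nat.pair 7 (Nat.pair a.code b.code) + 1
  | prec a b => Nat.pair 8 (Nat.pair a.code b.code) + 1

theorem code_ne_zero (c : Fn) : c.code ≠ 0 := by
  cases c <;> simp [code]

theorem code_injective : Function.Injective code := by
  intro c
  induction c with
  | pair a b iha ihb | comp a b iha ihb | prec a b iha ihb =>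
    intro d h
    cases d <;> simp only [code, Nat.add_right_cancel_iff, Nat.pair_eq_pair] at h <;> try omega
    rw [iha h.2.1, ihb h.2.2]
  | _ =>
    intro d h
    cases d <;> simp [code, Nat.pair_eq_pair] at h ⊢

instance : Nonempty Fn := ⟨id⟩

end Fn

/-! ### Two-variable logic of equations -/

/-- Classical formulas in negation normal form with two variables, named `false` and `true`;
`eq F s G t` is the equation `F s = G t`, and `ne F s G t` its negation. -/
inductive EqFormula : Type
  | eq (F : Fn) (s : Bool) (G : Fn) (t : Bool) : EqFormula
  | ne (F : Fn) (s : Bool) (G : Fn) (t : Bool) : EqFormula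
  | and (φ ψ : EqFormula) : EqFormula
  | or (φ ψ : EqFormula) : EqFormula
  | all (s : Bool) (φ : EqFormula) : EqFormula
  | ex (s : Bool) (φ : EqFormula) : EqFormula

namespace EqFormula

/-- Truth of a formula when the names `F` denote functions from `D` to `V` and the variables
`false`, `true` have the values `a`, `b`. -/
def Holds {D V : Type*} (I : Fn → D → V) : D → D → EqFormula → Prop
  | a, b, eq F s G t => I F (cond s b a) = I G (cond t b a)
  | a, b, ne F s G t => I F (cond s b a) ≠ I G (cond t b a)
  | a, b, and φ ψ => Holds I a b φ ∧ Holds I a b ψ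
  | a, b, or φ ψ => Holds I a b φ ∨ Holds I a b ψ
  | _, b, all false φ => ∀ a, Holds I a b φ
  | a, _, all true φ => ∀ b, Holds I a b φ
  | _, b, ex false φ => ∃ a, Holds I a b φ
  | a, _, ex true φ => ∃ b, Holds I a b φ

end EqFormula

/-! ### Translation into monadic intuitionistic formulas -/

/-- The individual variable that a variable of `EqFormula` becomes. -/
def varIndex (s : Bool) : ℕ := cond s 1 0

/-- The atomic formula for the value of `F` at the variable `s`. -/
def fnAtom (F : Fn) (s : Bool) : Formula := .atom 1 F.code fun _ => varIndex s

/-- The sentence that is refuted where the translation of an `EqFormula` is to hold. -/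
def refutand : Formula := .ex 0 (.atom 1 0 fun _ => 0)

/-- A formula which, where `refutand` fails, says that `p` is strictly stronger than `q`. -/
def strictImp (p q : Formula) : Formula :=
  .and (.imp (.imp q p) p) (.imp p refutand)

/-- The intuitionistic translation of a two-variable formula about unary functions. -/
def EqFormula.toFormula : EqFormula → Formula
  | eq F s G t => .and (.imp (fnAtom F s) (fnAtom G t)) (.imp (fnAtom G t) (fnAtom F s))
  | ne F s G t =>
    .or (strictImp (fnAtom F s) (fnAtom G t)) (strictImp (fnAtom G t) (fnAtom F s))
  | and φ ψ => .and φ.toFormula ψ.toFormula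
  | or φ ψ => .or φ.toFormula ψ.toFormula
  | all s φ => .all (varIndex s) φ.toFormula
  | ex s φ => .ex (varIndex s) φ.toFormula

/-- The formula that is to be refuted exactly when `ψ` has a model in which it is true under all
assignments. -/
def EqFormula.toRefutable (ψ : EqFormula) : Formula :=
  .imp (.all 0 (.all 1 ψ.toFormula)) refutand

theorem inTwoVarLanguage_fnAtom (F : Fn) (s : Bool) : (fnAtom F s).InTwoVarLanguage := by
  cases s <;> simp [fnAtom, Formula.InTwoVarLanguage, varIndex]

theorem inTwoVarLanguage_refutand : refutand.InTwoVarLanguage := by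
  simp [refutand, Formula.InTwoVarLanguage]

theorem EqFormula.inTwoVarLanguage_toFormula (φ : EqFormula) :
    φ.toFormula.InTwoVarLanguage := by
  induction φ with
  | eq F s G t =>
    simp [toFormula, Formula.InTwoVarLanguage, inTwoVarLanguage_fnAtom]
  | ne F s G t =>
    simp [toFormula, strictImp, Formula.InTwoVarLanguage, inTwoVarLanguage_fnAtom,
      inTwoVarLanguage_refutand]
  | and φ ψ ih₁ ih₂ | or φ ψ ih₁ ih₂ => exact ⟨ih₁, ih₂⟩
  | all s φ ih | ex s φ ih => exact ⟨by cases s <;> simp [varIndex], ih⟩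

theorem EqFormula.inTwoVarLanguage_toRefutable (ψ : EqFormula) :
    ψ.toRefutable.InTwoVarLanguage :=
  ⟨⟨.inl rfl, .inr rfl, ψ.inTwoVarLanguage_toFormula⟩, inTwoVarLanguage_refutand⟩

/-! ### From Kripke models to classical models -/

/-- The value of a function name at an individual of the world `v`: the set of worlds above `v` at
which the corresponding letter holds of the individual. -/
def Model.upSet {𝔉 : AugmentedFrame.{u}} (M : Model 𝔉) (v : 𝔉.World) (F : Fn) (a : 𝔉.D v) :
    Set 𝔉.World :=
  {w | 𝔉.R v w ∧ (fun _ => (a : 𝔉.Ind)) ∈ M.I w 1 F.code}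

/-- The truth set above `v` of an atom with values in the domain of `v`. -/
theorem Model.mem_upSet_iff {𝔉 : AugmentedFrame.{u}} (M : Model 𝔉) {v w : 𝔉.World} (hw : 𝔉.R v w)
    (F : Fn) (s : Bool) (g : ℕ → 𝔉.Ind) (a b : 𝔉.D v) (ha : g 0 = a) (hb : g 1 = b) :
    w ∈ M.upSet v F (cond s b a) ↔ M.Forces w g (fnAtom F s) := by
  cases s <;> simp [Model.upSet, fnAtom, Model.Forces, varIndex, hw, ha, hb]

theorem Model.upSet_subset {𝔉 : AugmentedFrame.{u}} (M : Model 𝔉) (v : 𝔉.World) (F G : Fn)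
    (s t : Bool) (g : ℕ → 𝔉.Ind) (a b : 𝔉.D v) (ha : g 0 = a) (hb : g 1 = b) :
    M.upSet v F (cond s b a) ⊆ M.upSet v G (cond t b a) ↔
      M.Forces v g (.imp (fnAtom F s) (fnAtom G t)) := by
  constructor
  · intro h w hw hF
    exact (M.mem_upSet_iff hw G t g a b ha hb).1
      (h ((M.mem_upSet_iff hw F s g a b ha hb).2 hF))
  · intro h w hw
    exact (M.mem_upSet_iff hw.1 G t g a b ha hb).2
      (h w hw.1 ((M.mem_upSet_iff hw.1 F s g a b ha hb).1 hw))

theorem Model.not_upSet_subset_of_forces_strictImp {𝔉 : AugmentedFrame.{u}} (M : Model 𝔉)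
    {v : 𝔉.World} {g : ℕ → 𝔉.Ind} (hB : ¬ M.Forces v g refutand) {F G : Fn}
    {s t : Bool} {a b : 𝔉.D v} (ha : g 0 = a) (hb : g 1 = b)
    (h : M.Forces v g (strictImp (fnAtom F s) (fnAtom G t))) :
    ¬ M.upSet v G (cond t b a) ⊆ M.upSet v F (cond s b a) := by
  intro hsub
  exact hB (h.2 v (𝔉.refl v)
    (h.1 v (𝔉.refl v) ((M.upSet_subset v G F t s g a b ha hb).1 hsub)))

theorem forces_refutand_iff {𝔉 : AugmentedFrame.{u}} (M : Model 𝔉) (v : 𝔉.World)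
    (g : ℕ → 𝔉.Ind) : M.Forces v g refutand ↔ ∃ a ∈ 𝔉.D v, (fun _ => a) ∈ M.I v 1 0 := by
  simp [refutand, Model.Forces]

/-- A world that forces the translation and does not force `refutand` yields a classical model on
its domain. -/
theorem EqFormula.holds_of_forces {𝔉 : AugmentedFrame.{u}} (M : Model 𝔉) {v : 𝔉.World}
    (hB : ∀ g, ¬ M.Forces v g refutand) (φ : EqFormula) (g : ℕ → 𝔉.Ind) (a b : 𝔉.D v)
    (ha : g 0 = a) (hb : g 1 = b) (h : M.Forces v g φ.toFormula) :
    φ.Holds (M.upSet v) a b := by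
  induction φ generalizing g a b with
  | eq F s G t =>
    exact ((M.upSet_subset v F G s t g a b ha hb).2 h.1).antisymm
      ((M.upSet_subset v G F t s g a b ha hb).2 h.2)
  | ne F s G t =>
    intro heq
    rcases h with h | h
    · exact M.not_upSet_subset_of_forces_strictImp (hB g) ha hb h heq.ge
    · exact M.not_upSet_subset_of_forces_strictImp (hB g) ha hb h heq.le
  | and φ ψ ih₁ ih₂ => exact ⟨ih₁ g a b ha hb h.1, ih₂ g a b ha hb h.2⟩
  | or φ ψ ih₁ ih₂ => exact h.imp (ih₁ g a b ha hb) (ih₂ g a b ha hb)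
  | all s φ ih =>
    cases s
    · exact fun c => ih _ c b (by simp [varIndex]) (by simp [varIndex, hb])
        (h v (𝔉.refl v) c c.2)
    · exact fun c => ih _ a c (by simp [varIndex, ha]) (by simp [varIndex])
        (h v (𝔉.refl v) c c.2)
  | ex s φ ih =>
    obtain ⟨c, hc, h⟩ := h
    cases s
    · exact ⟨⟨c, hc⟩, ih _ ⟨c, hc⟩ b (by simp [varIndex]) (by simp [varIndex, hb]) h⟩
    · exact ⟨⟨c, hc⟩, ih _ a ⟨c, hc⟩ (by simp [varIndex, ha]) (by simp [varIndex]) h⟩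

/-- A formula without classical models is translated into a formula valid on all augmented
frames. -/
theorem EqFormula.validates_toRefutable (ψ : EqFormula)
    (hψ : ∀ (D V : Type u) (I : Fn → D → V), Nonempty D → ¬ ∀ a b, ψ.Holds I a b)
    (𝔉 : AugmentedFrame.{u}) : 𝔉.Validates ψ.toRefutable := by
  intro M w g _ v _ hv
  by_contra hB
  have hB' : ∀ g, ¬ M.Forces v g refutand := by
    simpa only [forces_refutand_iff, forall_const] using fun _ : ℕ → 𝔉.Ind =>
      (forces_refutand_iff M v g).not.1 hB
  refine hψ (𝔉.D v) (Set 𝔉.World) (M.upSet v) (𝔉.dom_nonempty v).to_subtype fun a b => ?_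
  exact ψ.holds_of_forces M hB' (Function.update (Function.update g 0 a) 1 b) a b (by simp)
    (by simp) (hv v (𝔉.refl v) a a.2 v (𝔉.refl v) b b.2)

/-! ### From classical models to models on `⟨ℕ, ≤⟩ ⊙ ℕ` -/

/-- The world from which the `k`-th unary letter holds of `m`, for given values of the function
names. -/
noncomputable def threshold (I : Fn → ℕ → ℕ) (k m : ℕ) : ℕ :=
  if k = 0 then 1 else I (Function.invFun Fn.code k) m + 1

/-- The model on `⟨ℕ, ≤⟩ ⊙ ℕ` in which a letter holds of an individual from its threshold on. The
interpretation of the letters that are not unary is immaterial. -/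
noncomputable def thresholdModel (I : Fn → ℕ → ℕ) : Model (natFrame.constDomain ℕ) where
  I w _ k := {a : _ → ℕ | ∀ i, threshold I k (a i) ≤ (show ℕ from w)}
  mem_dom _ _ _ _ _ _ := Set.mem_univ _
  heredity _ _ h _ _ _ ha i := le_trans (ha i) h

theorem thresholdModel_forces_fnAtom (I : Fn → ℕ → ℕ) (w : ℕ) (g : ℕ → ℕ) (F : Fn) (s : Bool) :
    (thresholdModel I).Forces w g (fnAtom F s) ↔ I F (cond s (g 1) (g 0)) + 1 ≤ w := by
  have hF : Function.invFun Fn.code F.code = F := Function.leftInverse_invFun Fn.code_injective F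
  have : (thresholdModel I).Forces w g (fnAtom F s) ↔
      ∀ _ : Fin 1, threshold I F.code (g (varIndex s)) ≤ w := Iff.rfl
  rw [this]
  cases s <;> simp [threshold, Fn.code_ne_zero, hF, varIndex]

theorem thresholdModel_forces_refutand (I : Fn → ℕ → ℕ) (w : ℕ) (g : ℕ → ℕ) :
    (thresholdModel I).Forces w g refutand ↔ 1 ≤ w := by
  refine (forces_refutand_iff (thresholdModel I) w g).trans ⟨?_, ?_⟩
  · rintro ⟨a, -, ha⟩
    exact ha 0
  · exact fun h => ⟨(0 : ℕ), Set.mem_univ _, fun _ => h⟩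

theorem thresholdModel_forces_imp (I : Fn → ℕ → ℕ) (w : ℕ) (g : ℕ → ℕ) (φ ψ : Formula) :
    (thresholdModel I).Forces w g (.imp φ ψ) ↔
      ∀ v : ℕ, w ≤ v → (thresholdModel I).Forces v g φ → (thresholdModel I).Forces v g ψ :=
  Iff.rfl

theorem thresholdModel_forces_strictImp (I : Fn → ℕ → ℕ) (w : ℕ) (g : ℕ → ℕ) (F G : Fn)
    (s t : Bool) (h : I G (cond t (g 1) (g 0)) < I F (cond s (g 1) (g 0))) :
    (thresholdModel I).Forces w g (strictImp (fnAtom F s) (fnAtom G t)) := by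
  refine ⟨(thresholdModel_forces_imp ..).2 fun v _ hv => ?_,
    (thresholdModel_forces_imp ..).2 fun v _ hv => ?_⟩
  · rw [thresholdModel_forces_fnAtom]
    -- Otherwise the later of `v` and the threshold of `G` refutes `G t → F s`.
    by_contra hF
    have := (thresholdModel_forces_imp ..).1 hv (max v (I G (cond t (g 1) (g 0)) + 1))
      (le_max_left _ _)
      ((thresholdModel_forces_fnAtom ..).2 (le_max_right _ _))
    rw [thresholdModel_forces_fnAtom] at this
    omega
  · rw [thresholdModel_forces_fnAtom] at hv
    rw [thresholdModel_forces_refutand]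
    omega

theorem EqFormula.forces_of_holds (I : Fn → ℕ → ℕ) (φ : EqFormula) (w : ℕ) (g : ℕ → ℕ)
    (h : φ.Holds I (g 0) (g 1)) : (thresholdModel I).Forces w g φ.toFormula := by
  induction φ generalizing w g with
  | eq F s G t =>
    have h : I F (cond s (g 1) (g 0)) = I G (cond t (g 1) (g 0)) := h
    constructor <;> refine (thresholdModel_forces_imp ..).2 fun v _ hv => ?_ <;>
      rw [thresholdModel_forces_fnAtom] at hv ⊢ <;> omega
  | ne F s G t =>
    rcases lt_or_gt_of_ne h with h | h
    · exact Or.inr (thresholdModel_forces_strictImp I w g G F t s h)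
    · exact Or.inl (thresholdModel_forces_strictImp I w g F G s t h)
  | and φ ψ ih₁ ih₂ => exact ⟨ih₁ w g h.1, ih₂ w g h.2⟩
  | or φ ψ ih₁ ih₂ => exact h.imp (ih₁ w g) (ih₂ w g)
  | all s φ ih =>
    intro v _ (c : ℕ) _
    apply ih v (Function.update g (varIndex s) c)
    cases s <;> exact h c
  | ex s φ ih =>
    cases s
    all_goals
      obtain ⟨c, h⟩ := h
      exact ⟨c, Set.mem_univ _, ih w (Function.update g _ c) h⟩

/-- A formula true under all assignments in a model with domain and values `ℕ` is translated into a
formula refuted on `⟨ℕ, ≤⟩ ⊙ ℕ`. -/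
theorem EqFormula.not_validates_toRefutable (ψ : EqFormula) (I : Fn → ℕ → ℕ)
    (hψ : ∀ a b, ψ.Holds I a b) : ¬ (natFrame.constDomain ℕ).Validates ψ.toRefutable := by
  intro h
  have h₀ := h (thresholdModel I) (0 : ℕ) (fun _ => (0 : ℕ)) fun _ _ => Set.mem_univ _
  have h₁ := (thresholdModel_forces_imp ..).1 h₀ 0 le_rfl fun v _ a _ w _ b _ =>
    ψ.forces_of_holds I w _ (hψ _ _)
  exact absurd ((thresholdModel_forces_refutand ..).1 h₁) (by omega)

/-! ### Axioms for primitive recursive functions -/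

/-- The function that sends the code of `(z, k)` to the argument at which `b` yields the value of
`prec a b` at the code of `(z, k + 1)`. -/
def Fn.precArg (a b : Fn) : Fn :=
  .pair .left (.pair .right (.prec a b))

namespace EqFormula

/-- `∀ x ∃ y (y = b x ∧ a y = (comp a b) x)`. -/
def compAxiom (a b : Fn) : EqFormula :=
  .all false (.ex true (.and (.eq .id true b false) (.eq a true (.comp a b) false)))

/-- `∀ x ∃ y (y = (pair a b) x ∧ left y = a x ∧ right y = b x)`. -/
def pairAxiom (a b : Fn) : EqFormula :=
  .all false (.ex true (.and (.eq .id true (.pair a b) false)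
    (.and (.eq .left true a false) (.eq .right true b false))))

/-- The recursion equations of `h = prec a b`: for every `x`, either `right x = 0` and
`h x = a (left x)`, or there is a `y` with the same left component, whose right component is the
predecessor of that of `x`, and such that `h x = b (precArg y)`. -/
def precAxiom (a b : Fn) : EqFormula :=
  .all false (.or
    (.and (.eq .right false .zero false) (.eq (.prec a b) false (.comp a .left) false))
    (.ex true (.and (.eq .left true .left false)
      (.and (.eq (.comp .succ .right) true .right false)
        (.eq (.prec a b) false (.comp b (Fn.precArg a b)) true)))))

/-- The conjunction of the defining axioms of a function name and of the names it depends on. -/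
def definingAxioms : Fn → EqFormula
  | .pair a b => .and (definingAxioms a) (.and (definingAxioms b) (pairAxiom a b))
  | .comp a b => .and (definingAxioms a) (.and (definingAxioms b) (compAxiom a b))
  | .prec a b => .and (definingAxioms a) (.and (definingAxioms b)
      (.and (compAxiom a .left) (.and (pairAxiom .right (.prec a b))
        (.and (pairAxiom .left (.pair .right (.prec a b)))
          (.and (compAxiom b (Fn.precArg a b)) (precAxiom a b))))))
  | .lt => .and (compAxiom .succ .zero) (.all false (.or (.eq .lt false .zero false)
      (.eq .lt false (.comp .succ .zero) false)))
  | _ => .eq .id false .id false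

/-- Zero and successor: the function `zero` is constant, its value and all successors are in the
domain, the successor is well defined, injective and never zero. -/
def succAxioms : EqFormula :=
  .and (.all false (.all true (.eq .zero false .zero true)))
  (.and (.all false (.ex true (.eq .id true .zero false)))
  (.and (.all false (.ex true (.eq .id true .succ false)))
  (.and (.all false (.all true (.or (.ne .id false .id true) (.eq .succ false .succ true))))
  (.and (.all false (.ne .succ false .zero false))
    (.all false (.all true (.or (.ne .succ false .succ true) (.eq .id false .id true))))))))

/-- How the components `(l, r)` of a number change when `1` is added: `(l, l)` is followed by
`(0, l + 1)`, the pair `(l, l + 1)` by `(l + 1, 0)`; otherwise the smaller of the two components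
grows by `1`. -/
def unpairStep : EqFormula :=
  .or (.and (.eq .left false .right false)
    (.and (.eq .left true .zero false)
      (.and (.eq .right true (.comp .succ .left) false) (.ne .lt true .zero false))))
  (.or (.and (.eq (.comp .succ .left) false .right false)
    (.and (.eq .left true .right false)
      (.and (.eq .right true .zero false) (.eq .lt true .zero false))))
  (.and (.ne .left false .right false) (.and (.ne (.comp .succ .left) false .right false)
    (.or (.and (.ne .lt false .zero false)
      (.and (.eq .left true (.comp .succ .left) false)
        (.and (.eq .right true .right false) (.ne .lt true .zero false))))
    (.and (.eq .lt false .zero false)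
      (.and (.eq .left true .left false)
        (.and (.eq .right true (.comp .succ .right) false) (.eq .lt true .zero false))))))))

/-- The functions `left`, `right` and `lt`: a number is determined by its components, and these are
computed by recursion on the number. -/
def unpairAxioms : EqFormula :=
  .and (compAxiom .succ .left) (.and (compAxiom .succ .right)
  (.and (.all false (.all true (.or (.ne .left false .left true)
    (.or (.ne .right false .right true) (.eq .id false .id true)))))
  (.and (.all false (.or (.ne .id false .zero false) (.and (.eq .left false .zero false)
    (.and (.eq .right false .zero false) (.eq .lt false .zero false)))))
    (.all false (.all true (.or (.ne .id true .succ false) unpairStep))))))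

/-- The variable `true` has the value `n`. The inner quantifier `ex true` only renames the
variable of the predecessor, so that two variables are enough for all `n`. -/
def isNumeral : ℕ → EqFormula
  | 0 => .eq .id true .zero true
  | n + 1 => .ex false (.and (.eq .succ false .id true)
      (.ex true (.and (.eq .id true .id false) (isNumeral n))))

/-- There is no `m` with `left m = n` and `f m = 0`. -/
def noZero (f : Fn) (n : ℕ) : EqFormula :=
  .ex true (.and (isNumeral n)
    (.all false (.or (.ne .left false .id true) (.ne f false .zero false))))

/-- All axioms needed to compute `f` on standard numbers. -/
def arithAxioms (f : Fn) : EqFormula :=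
  .and succAxioms (.and unpairAxioms (definingAxioms f))

end EqFormula

/-! ### The standard model -/

theorem unpair_succ (l r : ℕ) : (Nat.pair l r + 1).unpair =
    if l = r then (0, l + 1) else if l + 1 = r then (r, 0) else
      if l < r then (l + 1, r) else (l, r + 1) := by
  have key : ∀ p : ℕ × ℕ, Nat.pair l r + 1 = Nat.pair p.1 p.2 →
      (Nat.pair l r + 1).unpair = p := by
    rintro ⟨a, b⟩ h
    rw [h, Nat.unpair_pair]
  split_ifs with h₁ h₂ h₃ <;> apply key
  · subst h₁
    simp [Nat.pair]
    ring
  · subst h₂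
    simp [Nat.pair]
    ring
  · have : l + 1 < r := by omega
    simp [Nat.pair, h₃, this]
    ring
  · have : ¬ l < r + 1 := by omega
    simp [Nat.pair, h₃, this]
    ring

namespace EqFormula

theorem holds_compAxiom (a b : Fn) (x y : ℕ) : (compAxiom a b).Holds Fn.interp x y :=
  fun x => ⟨b.interp x, rfl, rfl⟩

theorem holds_pairAxiom (a b : Fn) (x y : ℕ) : (pairAxiom a b).Holds Fn.interp x y :=
  fun x => ⟨(Fn.pair a b).interp x, rfl, by simp [Holds, Fn.interp], by simp [Holds, Fn.interp]⟩

theorem holds_precAxiom (a b : Fn) (x y : ℕ) : (precAxiom a b).Holds Fn.interp x y := by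
  intro x
  obtain ⟨z, k, rfl⟩ : ∃ z k, x = Nat.pair z k := ⟨_, _, (Nat.pair_unpair x).symm⟩
  cases k with
  | zero => exact Or.inl (by simp [Holds, Fn.interp])
  | succ k =>
    exact Or.inr ⟨Nat.pair z k, by simp [Holds, Fn.interp, Fn.precArg]⟩

theorem holds_definingAxioms (c : Fn) (x y : ℕ) : (definingAxioms c).Holds Fn.interp x y := by
  induction c with
  | pair a b iha ihb => exact ⟨iha, ihb, holds_pairAxiom a b x y⟩
  | comp a b iha ihb => exact ⟨iha, ihb, holds_compAxiom a b x y⟩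
  | prec a b iha ihb =>
    exact ⟨iha, ihb, holds_compAxiom _ _ x y, holds_pairAxiom _ _ x y,
      holds_pairAxiom _ _ x y, holds_compAxiom _ _ x y, holds_precAxiom a b x y⟩
  | lt =>
    refine ⟨holds_compAxiom _ _ x y, fun x => ?_⟩
    by_cases h : x.unpair.1 < x.unpair.2
    · exact .inr (by simp [Holds, Fn.interp, h])
    · exact .inl (by simp [Holds, Fn.interp, h])
  | _ => rfl

theorem holds_succAxioms (x y : ℕ) : succAxioms.Holds Fn.interp x y := by
  simp only [succAxioms, Holds, Fn.interp, cond]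
  exact ⟨fun _ _ => trivial, fun _ => ⟨_, rfl⟩, fun _ => ⟨_, rfl⟩, fun _ _ => by omega,
    fun _ => by omega, fun _ _ => by omega⟩

theorem holds_unpairAxioms (x y : ℕ) : unpairAxioms.Holds Fn.interp x y := by
  refine ⟨holds_compAxiom _ _ x y, holds_compAxiom _ _ x y, fun x y => ?_, fun x => ?_, fun x y => ?_⟩
  · by_cases h₁ : x.unpair.1 = y.unpair.1
    · by_cases h₂ : x.unpair.2 = y.unpair.2
      · have hxy : x = y := by simpa using congrArg₂ Nat.pair h₁ h₂
        exact .inr (.inr hxy)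
      · exact .inr (.inl h₂)
    · exact .inl h₁
  · by_cases h : x = 0
    · subst h
      exact .inr (by simp [Holds, Fn.interp])
    · exact .inl h
  · by_cases h : y = x + 1
    · subst h
      obtain ⟨l, r, rfl⟩ : ∃ l r, x = Nat.pair l r := ⟨_, _, (Nat.pair_unpair x).symm⟩
      refine .inr ?_
      simp only [unpairStep, Holds, Fn.interp, cond, unpair_succ, Nat.unpair_pair]
      split_ifs <;> simp <;> omega
    · exact .inl h

theorem holds_arithAxioms (f : Fn) (x y : ℕ) : (arithAxioms f).Holds Fn.interp x y :=
  ⟨holds_succAxioms x y, holds_unpairAxioms x y, holds_definingAxioms f x y⟩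

theorem holds_isNumeral (n x : ℕ) : (isNumeral n).Holds Fn.interp x n := by
  induction n generalizing x with
  | zero => rfl
  | succ n ih => exact ⟨n, rfl, n, rfl, ih n⟩

theorem holds_noZero {f : Fn} {n : ℕ} (h : ∀ m, m.unpair.1 = n → f.interp m ≠ 0) (x y : ℕ) :
    (noZero f n).Holds Fn.interp x y :=
  ⟨n, holds_isNumeral n x, fun m => (ne_or_eq m.unpair.1 n).imp_right (h m)⟩

end EqFormula

/-! ### Standard numbers in an arbitrary model -/

section Models

variable {D V : Type*} {I : Fn → D → V} {e : ℕ → D}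

/-- The elements `e 0, e 1, …` denote zero and its iterated successors, in a model of `succAxioms`
and `unpairAxioms`. -/
structure IsArithModel (I : Fn → D → V) (e : ℕ → D) : Prop where
  succAxioms : ∀ a b, EqFormula.succAxioms.Holds I a b
  unpairAxioms : ∀ a b, EqFormula.unpairAxioms.Holds I a b
  id_zero : ∀ x, I .id (e 0) = I .zero x
  id_succ : ∀ m, I .id (e (m + 1)) = I .succ (e m)

theorem exists_isArithModel [Nonempty D] (h₁ : ∀ a b, EqFormula.succAxioms.Holds I a b)
    (h₂ : ∀ a b, EqFormula.unpairAxioms.Holds I a b) : ∃ e : ℕ → D, IsArithModel I e := by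
  obtain ⟨d⟩ := ‹Nonempty D›
  obtain ⟨hconst, hzero, hsucc, -⟩ := h₁ d d
  obtain ⟨e₀, he₀⟩ := hzero d
  choose s hs using hsucc
  exact ⟨fun m => s^[m] e₀, h₁, h₂, fun x => he₀.trans (hconst d x), fun m => by
    rw [Function.iterate_succ_apply']
    exact hs _⟩

namespace IsArithModel

theorem zero_const (h : IsArithModel I e) (x y : D) : I .zero x = I .zero y :=
  (h.succAxioms x y).1 x y

theorem succ_congr (h : IsArithModel I e) {x y : D} (hxy : I .id x = I .id y) :
    I .succ x = I .succ y :=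
  ((h.succAxioms x y).2.2.2.1 x y).resolve_left (not_not_intro hxy)

theorem succ_ne (h : IsArithModel I e) (x y : D) : I .succ x ≠ I .zero y := by
  rw [h.zero_const y x]
  exact (h.succAxioms x y).2.2.2.2.1 x

theorem succ_inj (h : IsArithModel I e) {x y : D} (hxy : I .succ x = I .succ y) :
    I .id x = I .id y :=
  ((h.succAxioms x y).2.2.2.2.2 x y).resolve_left (not_not_intro hxy)

theorem pair_inj (h : IsArithModel I e) {x y : D} (hl : I .left x = I .left y)
    (hr : I .right x = I .right y) : I .id x = I .id y :=
  (((h.unpairAxioms x y).2.2.1 x y).resolve_left (not_not_intro hl)).resolve_left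
    (not_not_intro hr)

theorem numeral_zero_ne (h : IsArithModel I e) (m : ℕ) : I .id (e 0) ≠ I .id (e (m + 1)) := by
  rw [h.id_zero (e 0), h.id_succ]
  exact (h.succ_ne _ _).symm

theorem numeral_inj (h : IsArithModel I e) {m n : ℕ} :
    I .id (e m) = I .id (e n) ↔ m = n := by
  refine ⟨fun hmn => ?_, fun hmn => by rw [hmn]⟩
  induction m generalizing n with
  | zero =>
    cases n with
    | zero => rfl
    | succ n => exact absurd hmn (h.numeral_zero_ne n)
  | succ m ih =>
    cases n with
    | zero => exact absurd hmn.symm (h.numeral_zero_ne m)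
    | succ n =>
      rw [h.id_succ, h.id_succ] at hmn
      rw [ih (h.succ_inj hmn)]

end IsArithModel

/-- The function named `c` takes the intended value at (all elements denoting) the standard number
`m`. -/
def CorrectAt (I : Fn → D → V) (e : ℕ → D) (c : Fn) (m : ℕ) : Prop :=
  ∀ x, I .id x = I .id (e m) → I c x = I .id (e (c.interp m))

theorem CorrectAt.comp {a b : Fn} {m : ℕ}
    (hax : ∀ x y, (EqFormula.compAxiom a b).Holds I x y)
    (ha : CorrectAt I e a (b.interp m)) (hb : CorrectAt I e b m) :
    CorrectAt I e (.comp a b) m := by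
  intro x hx
  obtain ⟨y, hy, hay⟩ := hax x x x
  exact hay.symm.trans (ha y (hy.trans (hb x hx)))

namespace IsArithModel

theorem correctAt_zero (h : IsArithModel I e) (m : ℕ) : CorrectAt I e .zero m :=
  fun x _ => (h.id_zero x).symm

theorem correctAt_succ (h : IsArithModel I e) (m : ℕ) : CorrectAt I e .succ m :=
  fun _ hx => (h.succ_congr hx).trans (h.id_succ m).symm

/-- By induction on the standard number, following the recursion in `unpairStep`; the induction
needs `lt` along with the two components. -/
theorem correctAt_unpair (h : IsArithModel I e) (m : ℕ) :
    CorrectAt I e .left m ∧ CorrectAt I e .right m ∧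
      ∀ x, I .id x = I .id (e m) → (I .lt x = I .zero x ↔ ¬ m.unpair.1 < m.unpair.2) := by
  induction m with
  | zero =>
    have key : ∀ x, I .id x = I .id (e 0) →
        I .left x = I .zero x ∧ I .right x = I .zero x ∧ I .lt x = I .zero x := fun x hx =>
      ((h.unpairAxioms x x).2.2.2.1 x).resolve_left (not_not_intro (hx.trans (h.id_zero x)))
    refine ⟨fun x hx => ?_, fun x hx => ?_, fun x hx => ?_⟩
    · simpa [Fn.interp, h.id_zero x] using (key x hx).1
    · simpa [Fn.interp, h.id_zero x] using (key x hx).2.1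
    · simpa using (key x hx).2.2
  | succ m ih =>
    obtain ⟨ihl, ihr, ihlt⟩ := ih
    have hsl := (CorrectAt.comp (fun x y => (h.unpairAxioms x y).1)
      (h.correctAt_succ _) ihl) (e m) rfl
    have hsr := (CorrectAt.comp (fun x y => (h.unpairAxioms x y).2.1)
      (h.correctAt_succ _) ihr) (e m) rfl
    have hl := ihl (e m) rfl
    have hr := ihr (e m) rfl
    have hlt := ihlt (e m) rfl
    obtain ⟨l, r, rfl⟩ : ∃ l r, m = Nat.pair l r := ⟨_, _, (Nat.pair_unpair m).symm⟩
    have key : ∀ y, I .id y = I .id (e (Nat.pair l r + 1)) →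
        I .left y = I .id (e (Nat.pair l r + 1).unpair.1) ∧
        I .right y = I .id (e (Nat.pair l r + 1).unpair.2) ∧
        (I .lt y = I .zero y ↔
          ¬ (Nat.pair l r + 1).unpair.1 < (Nat.pair l r + 1).unpair.2) := by
      intro y hy
      have step := ((h.unpairAxioms y y).2.2.2.2 (e (Nat.pair l r)) y).resolve_left
        (not_not_intro (hy.trans (h.id_succ _)))
      simp only [EqFormula.unpairStep, EqFormula.Holds, cond, hl, hr, hsl, hsr, Fn.interp, ne_eq,
        Nat.unpair_pair, ← h.id_zero, h.numeral_inj] at step hlt ⊢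
      rw [unpair_succ]
      rcases step with ⟨h₀, h₁, h₂, h₃⟩ | ⟨h₀, h₁, h₂, h₃⟩ |
        ⟨h₀, h₀', ⟨h₁, h₂, h₃, h₄⟩ | ⟨h₁, h₂, h₃, h₄⟩⟩
      · simp [h₀, h₁, h₂, h₃]
      · subst h₀
        simp [h₁, h₂, h₃]
      · rw [hlt, not_not] at h₁
        simp [h₀, h₀', h₁, h₂, h₃, h₄]
        omega
      · rw [hlt] at h₁
        simp [h₀, h₀', h₁, h₂, h₃, h₄]
        omega
    exact ⟨fun y hy => (key y hy).1, fun y hy => (key y hy).2.1, fun y hy => (key y hy).2.2⟩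

/-- If `a` and `b` are correct at `m`, then so is their pairing. -/
theorem correctAt_pair (h : IsArithModel I e) {a b : Fn} {m : ℕ}
    (hax : ∀ x y, (EqFormula.pairAxiom a b).Holds I x y)
    (ha : CorrectAt I e a m) (hb : CorrectAt I e b m) :
    CorrectAt I e (.pair a b) m := by
  intro x hx
  obtain ⟨y, hy, hl, hr⟩ := hax x x x
  refine hy.symm.trans (h.pair_inj ?_ ?_)
  · rw [(h.correctAt_unpair _).1 _ rfl]
    simpa [Fn.interp] using hl.trans (ha x hx)
  · rw [(h.correctAt_unpair _).2.1 _ rfl]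
    simpa [Fn.interp] using hr.trans (hb x hx)

theorem correctAt_left (h : IsArithModel I e) (m : ℕ) : CorrectAt I e .left m :=
  (h.correctAt_unpair m).1

theorem correctAt_right (h : IsArithModel I e) (m : ℕ) : CorrectAt I e .right m :=
  (h.correctAt_unpair m).2.1

theorem exists_id_eq_of_comp_succ (h : IsArithModel I e) {y : D} :
    ∃ z, I .id z = I .right y ∧ I .succ z = I (.comp .succ .right) y :=
  (h.unpairAxioms y y).2.1 y

theorem correctAt_prec (h : IsArithModel I e) {a b : Fn}
    (hax : ∀ x y, (EqFormula.definingAxioms (.prec a b)).Holds I x y)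
    (ha : ∀ m, CorrectAt I e a m) (hb : ∀ m, CorrectAt I e b m) (m : ℕ) :
    CorrectAt I e (.prec a b) m := by
  have hleft := fun x y => (hax x y).2.2.1
  have hpair₁ := fun x y => (hax x y).2.2.2.1
  have hpair₂ := fun x y => (hax x y).2.2.2.2.1
  have hcomp := fun x y => (hax x y).2.2.2.2.2.1
  have hprec := fun x => (hax x x).2.2.2.2.2.2 x
  obtain ⟨z, k, rfl⟩ : ∃ z k, m = Nat.pair z k := ⟨_, _, (Nat.pair_unpair m).symm⟩
  induction k with
  | zero =>
    intro x hx
    rcases hprec x with ⟨-, hv⟩ | ⟨y, -, hr, -⟩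
    · refine hv.trans ?_
      simpa [Fn.interp] using CorrectAt.comp hleft (ha _) (h.correctAt_left _) x hx
    · -- A successor cannot be the second component of the code of `(z, 0)`.
      obtain ⟨w, -, hw⟩ := h.exists_id_eq_of_comp_succ (y := y)
      have := (hw.trans hr).trans (h.correctAt_right _ x hx)
      simp only [Fn.interp, Nat.unpair_pair, h.id_zero x] at this
      exact absurd this (h.succ_ne w x)
  | succ k ih =>
    intro x hx
    have hrx := h.correctAt_right _ x hx
    have hlx := h.correctAt_left _ x hx
    simp only [Fn.interp, Nat.unpair_pair] at hrx hlx
    rcases hprec x with ⟨hz, -⟩ | ⟨y, hl, hr, hv⟩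
    · have hz : I .right x = I .zero x := hz
      rw [hrx, ← h.id_zero, h.numeral_inj] at hz
      omega
    · -- The witness `y` can only be the code of `(z, k)`, where the value is known.
      have hy : I .id y = I .id (e (Nat.pair z k)) := by
        obtain ⟨w, hwy, hw⟩ := h.exists_id_eq_of_comp_succ (y := y)
        refine h.pair_inj ?_ ?_
        · rw [h.correctAt_left _ _ rfl]
          simpa [Fn.interp] using hl.trans hlx
        · rw [h.correctAt_right _ _ rfl, ← hwy]
          have := (hw.trans hr).trans hrx
          rw [h.id_succ] at this
          simpa [Fn.interp] using h.succ_inj this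
      refine hv.trans ?_
      simpa [Fn.interp, Fn.precArg] using CorrectAt.comp hcomp (hb _)
        (h.correctAt_pair hpair₂ (h.correctAt_left _)
          (h.correctAt_pair hpair₁ (h.correctAt_right _) ih)) y hy

/-- Every primitive recursive function takes the intended values on standard numbers. -/
theorem correctAt (h : IsArithModel I e) (c : Fn)
    (hax : ∀ x y, (EqFormula.definingAxioms c).Holds I x y) (m : ℕ) : CorrectAt I e c m := by
  induction c generalizing m with
  | id => exact fun _ hx => hx
  | zero => exact h.correctAt_zero m
  | succ => exact h.correctAt_succ m
  | left => exact h.correctAt_left m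
  | right => exact h.correctAt_right m
  | lt =>
    intro x hx
    have hlt := (h.correctAt_unpair m).2.2 x hx
    obtain ⟨hone, hax⟩ := hax x x
    by_cases hm : m.unpair.1 < m.unpair.2
    · refine ((hax x).resolve_left fun h₀ => hlt.1 h₀ hm).trans ?_
      obtain ⟨y, hy, hv⟩ := hone x
      refine hv.symm.trans ((h.correctAt_succ 0 y (hy.trans (h.id_zero x).symm)).trans ?_)
      simp [Fn.interp, hm]
    · rw [hlt.2 hm, ← h.id_zero]
      simp [Fn.interp, hm]
  | pair a b iha ihb =>
    exact h.correctAt_pair (fun x y => (hax x y).2.2) (iha (fun x y => (hax x y).1) m)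
      (ihb (fun x y => (hax x y).2.1) m)
  | comp a b iha ihb =>
    exact CorrectAt.comp (fun x y => (hax x y).2.2) (iha (fun x y => (hax x y).1) _)
      (ihb (fun x y => (hax x y).2.1) m)
  | prec a b iha ihb =>
    exact h.correctAt_prec hax (iha fun x y => (hax x y).1) (ihb fun x y => (hax x y).2.1) m

theorem eq_of_isNumeral (h : IsArithModel I e) {n : ℕ} {x y : D}
    (hn : (EqFormula.isNumeral n).Holds I x y) : I .id y = I .id (e n) := by
  induction n generalizing x y with
  | zero => exact hn.trans (h.id_zero y).symm
  | succ n ih =>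
    obtain ⟨z, hzy, w, hwz, hw⟩ := hn
    rw [h.id_succ, ← h.succ_congr (hwz.symm.trans (ih hw))]
    exact hzy.symm

theorem interp_ne_zero (h : IsArithModel I e) {f : Fn}
    (hax : ∀ x y, (EqFormula.definingAxioms f).Holds I x y) {n : ℕ} {x y : D}
    (hf : (EqFormula.noZero f n).Holds I x y) {m : ℕ} (hm : m.unpair.1 = n) :
    f.interp m ≠ 0 := by
  obtain ⟨z, hz, hf⟩ := hf
  intro h₀
  rcases hf (e m) with hne | hne
  · exact hne (((h.correctAt_left m) _ rfl).trans (by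
      rw [Fn.interp, hm]
      exact (h.eq_of_isNumeral hz).symm))
  · exact hne ((h.correctAt f hax m _ rfl).trans (by
      rw [h₀]
      exact h.id_zero _))

end IsArithModel

end Models

/-! ### The reduction -/

/-- The sentence that is satisfiable exactly when `f m ≠ 0` for all `m` with `(unpair m).1 = n`. -/
def noZeroTheory (f : Fn) (n : ℕ) : EqFormula :=
  .and (EqFormula.arithAxioms f) (EqFormula.noZero f n)

theorem validates_noZeroTheory {f : Fn} {n : ℕ} (h : ∃ m : ℕ, m.unpair.1 = n ∧ f.interp m = 0)
    (𝔉 : AugmentedFrame.{u}) : 𝔉.Validates (noZeroTheory f n).toRefutable := by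
  refine EqFormula.validates_toRefutable _ (fun D V I _ hI => ?_) 𝔉
  obtain ⟨m, hm, h₀⟩ := h
  obtain ⟨e, he⟩ := exists_isArithModel (fun a b => (hI a b).1.1) (fun a b => (hI a b).1.2.1)
  exact he.interp_ne_zero (fun a b => (hI a b).1.2.2) (hI (e 0) (e 0)).2 hm h₀

theorem not_validates_noZeroTheory {f : Fn} {n : ℕ}
    (h : ¬ ∃ m : ℕ, m.unpair.1 = n ∧ f.interp m = 0) :
    ¬ (natFrame.constDomain ℕ).Validates (noZeroTheory f n).toRefutable :=
  EqFormula.not_validates_toRefutable _ Fn.interp fun a b =>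
    ⟨EqFormula.holds_arithAxioms f a b,
      EqFormula.holds_noZero (fun m hm h₀ => h ⟨m, hm, h₀⟩) a b⟩

theorem primrec_code_isNumeral :
    Primrec fun n => (EqFormula.isNumeral n).toFormula.code := by
  -- The code of the formula for `n + 1` is `step` of the code of the formula for `n`.
  let step : ℕ → ℕ := fun c => Nat.pair 6 (Nat.pair 0 (Nat.pair 2 (Nat.pair
    (EqFormula.eq .succ false .id true).toFormula.code
    (Nat.pair 6 (Nat.pair 1 (Nat.pair 2 (Nat.pair
      (EqFormula.eq .id true .id false).toFormula.code c)))))))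
  have hpair : ∀ (k : ℕ) {g : ℕ → ℕ}, Primrec g → Primrec fun c => Nat.pair k (g c) :=
    fun k _ hg => Primrec₂.natPair.comp (Primrec.const k) hg
  have hstep : Primrec step := hpair _ (hpair _ (hpair _ (hpair _ (hpair _ (hpair _ (hpair _
    (hpair _ Primrec.id)))))))
  refine (Primrec.nat_rec₁ (EqFormula.isNumeral 0).toFormula.code
    (hstep.comp₂ Primrec₂.right)).of_eq fun n => ?_
  induction n with
  | zero => rfl
  | succ n ih => exact congrArg step ih

theorem computable_code_noZeroTheory (f : Fn) :
    Computable fun n => (noZeroTheory f n).toRefutable.code := by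
  have hpair : ∀ (k : ℕ) {g : ℕ → ℕ}, Primrec g → Primrec fun c => Nat.pair k (g c) :=
    fun k _ hg => Primrec₂.natPair.comp (Primrec.const k) hg
  have hpair' : ∀ (k : ℕ) {g : ℕ → ℕ}, Primrec g → Primrec fun c => Nat.pair (g c) k :=
    fun k _ hg => Primrec₂.natPair.comp hg (Primrec.const k)
  exact (hpair 4 (hpair' _ (hpair 5 (hpair 0 (hpair 5 (hpair 1 (hpair 2 (hpair _
    (hpair 6 (hpair 1 (hpair 2 (hpair' _ primrec_code_isNumeral)))))))))))).to_comp

/-- Recursively enumerable sets are projections of zero sets of primitive recursive functions. -/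
theorem exists_primrec_of_rePred {A : Set ℕ} (hA : REPred fun n => n ∈ A) :
    ∃ f : ℕ → ℕ, Nat.Primrec f ∧ ∀ n, n ∈ A ↔ ∃ m : ℕ, m.unpair.1 = n ∧ f m = 0 := by
  obtain ⟨c, hc⟩ := Nat.Partrec.Code.exists_code.1 hA
  let t : ℕ → Option ℕ := fun m => Nat.Partrec.Code.evaln m.unpair.2 c m.unpair.1
  have ht : Primrec t := Nat.Partrec.Code.primrec_evaln.comp
    (((Primrec.snd.comp Primrec.unpair).pair (Primrec.const c)).pair
      (Primrec.fst.comp Primrec.unpair))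
  refine ⟨fun m => if (t m).isSome then 0 else 1, Primrec.nat_iff.1
    (Primrec.ite (Primrec.eq.comp (Primrec.option_isSome.comp ht) (Primrec.const true))
      (Primrec.const 0) (Primrec.const 1)), fun n => ?_⟩
  have hdom : n ∈ A ↔ (c.eval n).Dom := by
    rw [hc]
    simp [Part.assert]
  rw [hdom, Part.dom_iff_mem]
  constructor
  · rintro ⟨x, hx⟩
    obtain ⟨k, hk⟩ := Nat.Partrec.Code.evaln_complete.1 hx
    exact ⟨Nat.pair n k, by simp, by simp [t, Option.mem_def.1 hk]⟩
  · rintro ⟨m, rfl, hm⟩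
    have : (t m).isSome := by
      by_contra hn
      simp [hn] at hm
    obtain ⟨x, hx⟩ := Option.isSome_iff_exists.1 this
    exact ⟨x, Nat.Partrec.Code.evaln_sound hx⟩

end SIL

theorem theorem2 (L : Set SIL.Formula) (hQLC : SIL.QLC.{u} ⊆ L)
    (hNat : L ⊆ SIL.QSIL {SIL.natFrame.constDomain ℕ}) :
    SIL.SigmaZeroOneHardIn {φ | φ.InTwoVarLanguage} L := by
  intro A hA
  obtain ⟨f, hf, hAf⟩ := SIL.exists_primrec_of_rePred hA
  obtain ⟨c, rfl⟩ := SIL.Fn.exists_interp_eq hf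
  refine ⟨fun n => (SIL.noZeroTheory c n).toRefutable, SIL.computable_code_noZeroTheory c,
    fun n => ⟨SIL.EqFormula.inTwoVarLanguage_toRefutable _, ?_⟩⟩
  rw [hAf]
  refine ⟨fun h => hQLC fun 𝔉 _ => SIL.validates_noZeroTheory h 𝔉, fun h => ?_⟩
  by_contra hn
  exact SIL.not_validates_noZeroTheory hn (hNat h _ rfl)
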